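/- Let $n$ be a positive integer and let ${\cal F}\subseteq 2^{[n]}$ be a hypergraph, that is, a family of non-empty subsets of $[n]=\{1,\ldots,n\}$. The Kneser graph ${\rm KG}({\cal F})$ has the members of ${\cal F}$ as its vertices, two of them being adjacent if and only if they are disjoint. For a sequence $X=(x_1,\ldots,x_n)\in\{-1,0,+1\}^n$ put $X^{+}=\{i: x_i=+1\}$ and $X^{-}=\{i: x_i=-1\}$, and for a permutation $\sigma$ of $[n]$ let $alt_\sigma(X)$ be the length of a longest subsequence of non-zero terms of $(x_{\sigma(1)},\ldots,x_{\sigma(n)})$ in which any two consecutive terms are different. Let $alt_{2,\sigma}({\cal F})$ be the maximum of $alt_\sigma(X)$ over all $X\in\{-1,0,+1\}^n\setminus\{(0,\ldots,0)\}$ such that neither $X^{+}$ nor $X^{-}$ contains a member of ${\cal F}$ (and $0$ if there is no such $X$), and let $alt_2({\cal F})=\min_{\sigma} alt_{2,\sigma}({\cal F})$, the minimum being over all permutations $\sigma$ of $[n]$. Let $r=n-alt_2({\cal F})$. Then, for every $k$ and every proper coloring of ${\rm KG}({\cal F})$ with colors $\{1,2,\ldots,k\}$, the graph ${\rm KG}({\cal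 F})$ contains a complete bipartite graph $K_{\lceil r/2\rceil,\lfloor r/2\rfloor}$ as a (not necessarily induced) subgraph such that its $r$ vertices receive $r$ different colors, and these $r$ colors, listed in their natural order, alternate between the two sides of the bipartite graph. -/

import Mathlib

namespace KneserAlt

/-- `alt(x)` for a finite sequence `x` of elements of `S ∪ {0}`, where `none` plays the role of `0`:
the largest length `k` of a subsequence `x (j 0), …, x (j (k-1))`, with `j 0 < ⋯ < j (k-1)`, all of
whose terms are non-zero and any two consecutive terms of which are different. -/
noncomputable def alt {S : Type*} {n : ℕ} (x : Fin n → Option S) : ℕ :=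
  sSup {k : ℕ | ∃ j : Fin k → Fin n, StrictMono j ∧ (∀ i, x (j i) ≠ none) ∧
    ∀ i i' : Fin k, (i : ℕ) + 1 = i' → x (j i) ≠ x (j i')}

/-- The part `X^s` of a signed set `X`: the set of all positions that carry the sign `s`. -/
def part {S : Type*} [DecidableEq S] {n : ℕ} (X : Fin n → Option S) (s : S) : Finset (Fin n) :=
  Finset.univ.filter fun i => X i = some s

/-- The first alternation number of `F` with respect to `r` signs and the linear ordering
`σ 0, …, σ (n-1)` of the ground set: the largest value of
`alt (X (σ 0), …, X (σ (n-1)))` over the non-zero signed sets `X`, no part of which contains a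
member of `F`. (It is `0` if there is no such `X`, that is, if every singleton is in `F`.) -/
noncomputable def altPerm (r : ℕ) {n : ℕ} (F : Finset (Finset (Fin n)))
    (σ : Equiv.Perm (Fin n)) : ℕ :=
  sSup {k : ℕ | ∃ X : Fin n → Option (Fin r), (∃ i, X i ≠ none) ∧
    (∀ s : Fin r, ∀ A ∈ F, ¬ A ⊆ part X s) ∧ alt (X ∘ σ) = k}

/-- The first alternation number `alt_r(F)`: the minimum of `altPerm r F σ` over all linear
orderings `σ` of the ground set. -/
noncomputable def altNumber (r : ℕ) {n : ℕ} (F : Finset (Finset (Fin n))) : ℕ :=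
  ⨅ σ : Equiv.Perm (Fin n), altPerm r F σ

/-- The Kneser graph `KG(F)`: its vertices are the members of `F`, and two distinct ones are
adjacent if and only if they are disjoint. -/
def kneserGraph {n : ℕ} (F : Finset (Finset (Fin n))) : SimpleGraph {A // A ∈ F} where
  Adj A B := A ≠ B ∧ Disjoint A.1 B.1
  symm := ⟨fun _ _ h => ⟨h.1.symm, h.2.symm⟩⟩
  loopless := ⟨fun _ h => h.1 rfl⟩

/-- The colors `col` of the vertices of a bipartite graph with sides `α` and `β` alternate between
the two sides with respect to the order of the colors: two vertices that have consecutive colors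
among the colors that occur always lie on different sides. -/
def ColorsAlternate {α β C : Type*} [LT C] (col : α ⊕ β → C) : Prop :=
  ∀ u v : α ⊕ β, col u < col v → (∀ w, ¬ (col u < col w ∧ col w < col v)) →
    u.isLeft ≠ v.isLeft

/-- The set whose supremum defines `alt x` is bounded by the length of `x`. -/
theorem alt_le {S : Type*} {n : ℕ} (x : Fin n → Option S) : alt x ≤ n := by
  refine csSup_le' ?_
  rintro k ⟨j, hj, -⟩
  simpa using Fintype.card_le_of_injective j hj.injective

/-- `alt_r(F) ≤ n`, so the difference `n - alt_r(F)` of natural numbers is never truncated. -/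
theorem altNumber_le (r : ℕ) {n : ℕ} (F : Finset (Finset (Fin n))) : altNumber r F ≤ n := by
  refine (ciInf_le' _ (Equiv.refl _)).trans (csSup_le' ?_)
  rintro k ⟨X, -, -, rfl⟩
  exact alt_le _

end KneserAlt

namespace KneserAlt

open Finset

/-! Flags of non-zero signed sets are the simplices of the barycentric subdivision of the
cross-polytope's boundary. Ky Fan's lemma (`IsFanLabelling.sum_ind_labels`) gives, for an antipodal
labelling without complementary edges, a maximal flag whose `n` labels alternate in sign as their
absolute values increase.

Fix `σ` attaining the minimum. An admissible `X` gets absolute value `alt (X ∘ σ) - 1`, below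
`altPerm 2 F σ`, and its first sign; any other `X` gets `altPerm 2 F σ` plus the largest color of a
member of `F` inside a part, and the sign of that part. Properness excludes complementary edges
(`HasLabel.ne_flip`). In the alternating flag the last `n - altPerm 2 F σ` labels are too large for
admissible sets, so they yield members of `F` with increasing colors, lying alternately in the two
disjoint parts of the top of the flag (`exists_zigzag`). -/

/-! ### Alternating multisets of signed labels -/

/-- A label: an absolute value together with a sign, ordered lexicographically. -/
abbrev Label := ℕ ×ₗ Fin 2

/-- The label with the same absolute value and the opposite sign. -/
def flip (p : Label) : Label := toLex ((ofLex p).1, (ofLex p).2 + 1)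

/-- The indicator, modulo 2, of the lists of labels whose signs alternate, starting with `b`. -/
def altInd : Fin 2 → List Label → ZMod 2
  | _, [] => 1
  | b, x :: l => if (ofLex x).2 = b then altInd (b + 1) l else 0

theorem fin_two_add_one_add_one (b : Fin 2) : b + 1 + 1 = b := by revert b; decide

theorem fin_two_eq_add_one_of_ne {a b : Fin 2} : a ≠ b → a = b + 1 := by
  revert a b; decide

theorem fin_two_add_one_ne (b : Fin 2) : b + 1 ≠ b := by revert b; decide

theorem flip_flip (p : Label) : flip (flip p) = p := by
  simp [flip, fin_two_add_one_add_one]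

/-- If `x = y`, sortedness forces `l` to begin with `y` too, so it does not matter which copy is
erased. -/
theorem erase_cons_of_pairwise_le {α : Type*} [LinearOrder α] [BEq α] [LawfulBEq α] {x y : α} {l : List α}
    (h : (y :: l).Pairwise (· ≤ ·)) (hx : x ∈ l) : (y :: l).erase x = y :: l.erase x := by
  by_cases hxy : y = x
  · subst hxy
    rw [List.erase_cons_head]
    cases l with
    | nil => simp at hx
    | cons z t =>
      have hz : z = y := by
        apply le_antisymm _ ((List.pairwise_cons.1 h).1 z (by simp))
        rcases List.mem_cons.1 hx with e | e
        · exact e.ge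
        · exact (List.pairwise_cons.1 (List.pairwise_cons.1 h).2).1 _ e
      subst hz
      simp
  · rw [List.erase_cons_tail (by simpa using hxy)]

/-- Modulo 2, the number of facets of a simplex whose labels alternate starting with `b` counts
the alternating sign patterns of the whole simplex. -/
theorem sum_altInd_erase [BEq Label] [LawfulBEq Label] (b : Fin 2) (l : List Label) (h : l.Pairwise (· ≤ ·)) :
    (l.map fun x => altInd b (l.erase x)).sum = altInd b l + altInd (b + 1) l := by
  induction l generalizing b with
  | nil => simp [altInd]; decide
  | cons y l ih =>
    have h2 := (List.pairwise_cons.1 h).2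
    have e : (l.map fun x => altInd b ((y :: l).erase x)) =
        l.map fun x => altInd b (y :: l.erase x) := by
      refine List.map_congr_left fun x hx => ?_
      rw [erase_cons_of_pairwise_le h hx]
    rw [List.map_cons, List.sum_cons, e, List.erase_cons_head]
    by_cases hy : (ofLex y).2 = b
    · have hb : b ≠ b + 1 := (fin_two_add_one_ne b).symm
      -- The term that erases `y` cancels one of the two terms of the induction hypothesis.
      simp only [altInd, hy, if_true, if_neg hb, ih (b + 1) h2, fin_two_add_one_add_one]
      rw [add_comm (altInd (b + 1) l), ← add_assoc, CharTwo.add_self_eq_zero, zero_add, add_zero]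
    · have hy' := fin_two_eq_add_one_of_ne hy
      have hb : b + 1 ≠ b := fin_two_add_one_ne b
      simp [altInd, hy', fin_two_add_one_add_one]

/-- The indicator, modulo 2, of the multisets of labels whose signs alternate, starting with `b`,
when the labels are listed in increasing order. -/
def ind (b : Fin 2) (M : Multiset Label) : ZMod 2 := altInd b (M.sort (· ≤ ·))

theorem ind_coe (b : Fin 2) {l : List Label} (h : l.Pairwise (· ≤ ·)) :
    ind b (l : Multiset Label) = altInd b l := by
  unfold ind
  congr 1
  refine List.Perm.eq_of_pairwise (fun a b _ _ => le_antisymm) (Multiset.pairwise_sort _ _) h ?_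
  rw [← Multiset.coe_eq_coe, Multiset.sort_eq]

theorem sum_ind_erase (b : Fin 2) (M : Multiset Label) :
    (M.map fun x => ind b (M.erase x)).sum = ind b M + ind (b + 1) M := by
  have h := Multiset.pairwise_sort M (· ≤ ·)
  obtain ⟨l, hl⟩ : ∃ l, l = M.sort (· ≤ ·) := ⟨_, rfl⟩
  have hM : M = (l : Multiset Label) := by rw [hl, Multiset.sort_eq]
  have sub : ∀ (_ : BEq Label) (x : Label), (l.erase x).Sublist l :=
    fun _ _ => List.erase_sublist
  rw [← hl] at h
  rw [hM, ind_coe _ h, ind_coe _ h, ← @sum_altInd_erase instBEqOfDecidableEq _ b l h, Multiset.map_coe, Multiset.sum_coe]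
  congr 1
  refine List.map_congr_left fun x _ => ?_
  rw [Multiset.coe_erase]
  refine ind_coe b (h.sublist ?_)
  exact sub _ x

/-- Flipping can reverse the order only of labels with equal absolute values and opposite signs,
that is, of complementary ones. -/
theorem flip_le_flip {x y : Label} (h : x ≤ y) (hxy : y ≠ flip x) : flip x ≤ flip y := by
  rw [Prod.Lex.le_iff] at h ⊢
  rcases h with h | ⟨h, -⟩
  · exact Or.inl h
  · refine Or.inr ⟨h, le_of_eq ?_⟩
    by_contra h2
    apply hxy
    have : (ofLex y).2 = (ofLex x).2 + 1 := by
      apply fin_two_eq_add_one_of_ne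
      rintro h3
      exact h2 (by simp [flip, h3])
    exact ofLex_inj.1 (Prod.ext h.symm this)

theorem altInd_map_flip (b : Fin 2) (l : List Label) :
    altInd b (l.map flip) = altInd (b + 1) l := by
  induction l generalizing b with
  | nil => rfl
  | cons x l ih =>
    simp only [List.map_cons, altInd, ih]
    have : ((ofLex (flip x)).2 = b) ↔ ((ofLex x).2 = b + 1) := by
      change (ofLex x).2 + 1 = b ↔ _
      generalize (ofLex x).2 = c
      revert b c; decide
    simp only [this]

theorem ind_map_flip (b : Fin 2) (M : Multiset Label) (hM : ∀ x ∈ M, ∀ y ∈ M, y ≠ flip x) :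
    ind b (M.map flip) = ind (b + 1) M := by
  have h := Multiset.pairwise_sort M (· ≤ ·)
  obtain ⟨l, hl⟩ : ∃ l, l = M.sort (· ≤ ·) := ⟨_, rfl⟩
  have hM' : M = (l : Multiset Label) := by rw [hl, Multiset.sort_eq]
  rw [← hl] at h
  subst hM'
  rw [ind_coe _ h, Multiset.map_coe, ind_coe, altInd_map_flip]
  rw [List.pairwise_map]
  exact h.imp_of_mem fun {x y} hx hy hxy => flip_le_flip hxy (hM x hx y hy)

/-! ### Ky Fan's lemma for the barycentric subdivision of the cross-polytope -/

/-- The opposite signed set. -/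
def antipode {n : ℕ} (X : Fin n → Option (Fin 2)) : Fin n → Option (Fin 2) :=
  fun i => (X i).map (· + 1)

/-- The vertices of the flag of signed sets that is given by a ranking `ρ` of the ground set and
by the signs `s` of its elements. -/
def vertex {n : ℕ} (ρ : Equiv.Perm (Fin n)) (s : Fin n → Fin 2) (j : Fin n) :
    Fin n → Option (Fin 2) :=
  fun i => if j ≤ ρ i then some (s i) else none

/-- The labels of the vertices of a flag. -/
def labels {n : ℕ} (lam : (Fin n → Option (Fin 2)) → Label) (ρ : Equiv.Perm (Fin n))
    (s : Fin n → Fin 2) : Multiset Label :=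
  (univ : Finset (Fin n)).val.map fun j => lam (vertex ρ s j)

/-- The labels of the facet of a flag that omits its vertex `j`. -/
def facet {n : ℕ} (lam : (Fin n → Option (Fin 2)) → Label) (ρ : Equiv.Perm (Fin n))
    (s : Fin n → Fin 2) (j : Fin n) : Multiset Label :=
  (univ.erase j : Finset (Fin n)).val.map fun j => lam (vertex ρ s j)

/-- An antipodal labelling of the non-zero signed sets without complementary edges. -/
structure IsFanLabelling {n : ℕ} (lam : (Fin n → Option (Fin 2)) → Label) : Prop where
  antipodal : ∀ X, (∃ i, X i ≠ none) → lam (antipode X) = flip (lam X)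
  not_compl : ∀ X Y, (∃ i, X i ≠ none) → (∀ i s, X i = some s → Y i = some s) →
    lam Y ≠ flip (lam X)

theorem exists_vertex_ne_none {n : ℕ} (ρ : Equiv.Perm (Fin n)) (s : Fin n → Fin 2) (j : Fin n) :
    ∃ i, vertex ρ s j i ≠ none :=
  ⟨ρ.symm j, by simp [vertex]⟩

theorem vertex_subset {n : ℕ} (ρ : Equiv.Perm (Fin n)) (s : Fin n → Fin 2) {j j' : Fin n}
    (h : j ≤ j') (i : Fin n) (t : Fin 2) (ht : vertex ρ s j' i = some t) :
    vertex ρ s j i = some t := by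
  unfold vertex at *
  split_ifs at ht with h1
  rw [if_pos (h.trans h1), ht]

theorem sum_ind_facet {n : ℕ} (lam : (Fin n → Option (Fin 2)) → Label) (ρ : Equiv.Perm (Fin n))
    (s : Fin n → Fin 2) (b : Fin 2) :
    ∑ j, ind b (facet lam ρ s j) = ind b (labels lam ρ s) + ind (b + 1) (labels lam ρ s) := by
  rw [← sum_ind_erase, labels, Multiset.map_map, Finset.sum]
  congr 1
  refine Multiset.map_congr rfl fun j hj => ?_
  rw [facet, Finset.erase_val, Multiset.map_erase_of_mem _ _ hj]
  rfl

theorem IsFanLabelling.labels_ne {n : ℕ} {lam : (Fin n → Option (Fin 2)) → Label}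
    (h : IsFanLabelling lam) (ρ : Equiv.Perm (Fin n)) (s : Fin n → Fin 2) :
    ∀ x ∈ labels lam ρ s, ∀ y ∈ labels lam ρ s, y ≠ flip x := by
  intro x hx y hy
  obtain ⟨i, -, rfl⟩ := Multiset.mem_map.1 hx
  obtain ⟨j, -, rfl⟩ := Multiset.mem_map.1 hy
  rcases le_total j i with hij | hij
  · exact h.not_compl _ _ (exists_vertex_ne_none ρ s i) (vertex_subset ρ s hij)
  · intro e
    refine h.not_compl _ _ (exists_vertex_ne_none ρ s j) (vertex_subset ρ s hij) ?_
    rw [e, flip_flip]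

theorem vertex_add_one {n : ℕ} (ρ : Equiv.Perm (Fin n)) (s : Fin n → Fin 2) (j : Fin n) :
    vertex ρ (fun i => s i + 1) j = antipode (vertex ρ s j) := by
  funext i
  simp only [vertex, antipode]
  split_ifs <;> rfl

theorem IsFanLabelling.labels_add_one {n : ℕ} {lam : (Fin n → Option (Fin 2)) → Label}
    (h : IsFanLabelling lam) (ρ : Equiv.Perm (Fin n)) (s : Fin n → Fin 2) :
    labels lam ρ (fun i => s i + 1) = (labels lam ρ s).map flip := by
  rw [labels, labels, Multiset.map_map]
  refine Multiset.map_congr rfl fun j _ => ?_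
  rw [vertex_add_one, h.antipodal _ (exists_vertex_ne_none ρ s j)]
  rfl

/-- Exchanging the ranks `j` and `j + 1` changes only the vertex that separates them, which this
facet omits. -/
theorem facet_swap {n : ℕ} (lam : (Fin (n + 1) → Option (Fin 2)) → Label)
    (ρ : Equiv.Perm (Fin (n + 1))) (s : Fin (n + 1) → Fin 2) (j : Fin n) :
    facet lam (Equiv.swap j.castSucc j.succ * ρ) s j.succ = facet lam ρ s j.succ := by
  refine Multiset.map_congr rfl fun j' hj' => ?_
  have hj : j' ≠ j.succ := Finset.ne_of_mem_erase (Finset.mem_def.2 hj')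
  congr 1
  funext i
  have : j' ≤ (Equiv.swap j.castSucc j.succ * ρ) i ↔ j' ≤ ρ i := by
    rw [Equiv.Perm.mul_apply, Equiv.swap_apply_def]
    have hj1 : (j' : ℕ) ≠ j + 1 := fun e => hj (Fin.ext e)
    split_ifs with h1 h2
    · rw [h1, Fin.le_def, Fin.le_def, Fin.val_succ, Fin.val_castSucc]
      omega
    · rw [h2, Fin.le_def, Fin.le_def, Fin.val_succ, Fin.val_castSucc]
      omega
    · rfl
  simp only [vertex, this]

theorem sum_ind_facet_succ {n : ℕ} (lam : (Fin (n + 1) → Option (Fin 2)) → Label)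
    (s : Fin (n + 1) → Fin 2) (j : Fin n) (b : Fin 2) :
    ∑ ρ, ind b (facet lam ρ s j.succ) = 0 := by
  refine Finset.sum_involution (fun ρ _ => Equiv.swap j.castSucc j.succ * ρ) ?_ ?_ ?_ ?_
  · intro ρ _
    rw [facet_swap, CharTwo.add_self_eq_zero]
  · intro ρ _ _ e
    exact absurd (Equiv.swap_eq_one_iff.1 (mul_eq_right.1 e)) (by simp [Fin.ext_iff])
  · simp
  · intro ρ _
    simp [← mul_assoc]

/-- The element of rank `0` lies only in the top vertex of the flag, so without that vertex its sign
is invisible. -/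
theorem facet_zero_update {n : ℕ} (lam : (Fin (n + 1) → Option (Fin 2)) → Label)
    (ρ : Equiv.Perm (Fin (n + 1))) (s : Fin (n + 1) → Fin 2) (i : Fin (n + 1)) (hi : ρ i = 0)
    (t : Fin 2) :
    facet lam ρ (Function.update s i t) 0 = facet lam ρ s 0 := by
  refine Multiset.map_congr rfl fun j' hj' => ?_
  have hj : j' ≠ 0 := Finset.ne_of_mem_erase (Finset.mem_def.2 hj')
  congr 1
  funext i'
  unfold vertex
  by_cases e : i' = i
  · subst e
    rw [hi, if_neg, if_neg] <;> simpa using hj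
  · rw [Function.update_of_ne e]

theorem sum_ind_facet_zero {n : ℕ} (lam : (Fin (n + 1) → Option (Fin 2)) → Label)
    (ρ : Equiv.Perm (Fin (n + 1))) (hρ : ρ 0 ≠ 0) (a b : Fin 2) :
    ∑ s : Fin n → Fin 2, ind b (facet lam ρ (Fin.cons a s) 0) = 0 := by
  obtain ⟨i, hi⟩ : ∃ i : Fin n, ρ i.succ = 0 := by
    obtain ⟨i, hi⟩ := ρ.surjective 0
    have : i ≠ 0 := by rintro rfl; exact hρ hi
    obtain ⟨i', rfl⟩ := Fin.exists_succ_eq.2 this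
    exact ⟨i', hi⟩
  refine Finset.sum_involution (fun s _ => Function.update s i (s i + 1)) ?_ ?_ ?_ ?_
  · intro s _
    rw [Fin.cons_update, facet_zero_update _ _ _ _ hi, CharTwo.add_self_eq_zero]
  · intro s _ _ e
    have := congrFun e i
    rw [Function.update_self] at this
    exact fin_two_add_one_ne _ this
  · simp
  · intro s _
    simp [fin_two_add_one_add_one]

/-- Here the element `0` has rank `0`, so the facet omitting the top vertex lies on the equator
where coordinate `0` vanishes; this drives the induction on dimension. -/
theorem facet_zero_decomposeFin {n : ℕ} (lam : (Fin (n + 1) → Option (Fin 2)) → Label)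
    (ρ : Equiv.Perm (Fin n)) (s : Fin n → Fin 2) (a : Fin 2) :
    facet lam (Equiv.Perm.decomposeFin.symm (0, ρ)) (Fin.cons a s) 0 =
      labels (fun X => lam (Fin.cons none X)) ρ s := by
  have : (univ.erase 0 : Finset (Fin (n + 1))) = univ.map (Fin.succEmb n) := by
    ext i
    simp [Fin.exists_succ_eq]
  rw [facet, this, Finset.map_val, Multiset.map_map, labels]
  refine Multiset.map_congr rfl fun j _ => ?_
  simp only [Function.comp]
  congr 1
  funext i
  refine Fin.cases ?_ (fun i => ?_) i
  · simp [vertex, Equiv.Perm.decomposeFin_symm_apply_zero]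
  · simp [vertex, Equiv.Perm.decomposeFin_symm_apply_succ]

theorem IsFanLabelling.cons_none {n : ℕ} {lam : (Fin (n + 1) → Option (Fin 2)) → Label}
    (h : IsFanLabelling lam) :
    IsFanLabelling fun X : Fin n → Option (Fin 2) => lam (Fin.cons none X) where
  antipodal X hX := by
    obtain ⟨i, hi⟩ := hX
    rw [← h.antipodal _ ⟨i.succ, by simpa using hi⟩]
    congr 1
    funext i
    refine Fin.cases ?_ (fun i => ?_) i <;> simp [antipode]
  not_compl X Y hX hXY := by
    obtain ⟨i, hi⟩ := hX
    refine h.not_compl _ _ ⟨i.succ, by simpa using hi⟩ fun i => ?_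
    refine Fin.cases ?_ (fun i => ?_) i
    · simp
    · simpa using hXY i

theorem sum_fin_two_cons {n : ℕ} {M : Type*} [AddCommMonoid M]
    (f : (Fin (n + 1) → Fin 2) → M) :
    ∑ s, f s = ∑ s : Fin n → Fin 2, (f (Fin.cons 0 s) + f (Fin.cons 1 s)) := by
  rw [← (Fin.consEquiv fun _ => Fin 2).sum_comp, Fintype.sum_prod_type, Fin.sum_univ_two,
    ← Finset.sum_add_distrib]
  rfl

/-- Ky Fan's lemma: the number of flags whose labels alternate, starting with the sign `0`,
is odd. -/
theorem IsFanLabelling.sum_ind_labels {n : ℕ} {lam : (Fin n → Option (Fin 2)) → Label}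
    (h : IsFanLabelling lam) : ∑ ρ, ∑ s, ind 0 (labels lam ρ s) = 1 := by
  induction n with
  | zero => simp [labels, ind, altInd]
  | succ n ih =>
    -- The antipode turns patterns starting with `0` into those starting with `1`. So all flags with
    -- start `0` are counted by the flags of the hemisphere `s 0 = 0` with either start, hence by
    -- their facets.
    have key : ∀ ρ, ∑ s, ind 0 (labels lam ρ s) =
        ∑ s : Fin n → Fin 2, ∑ j, ind 0 (facet lam ρ (Fin.cons 0 s) j) := by
      intro ρ
      have e : ∑ s : Fin n → Fin 2, ind 0 (labels lam ρ (Fin.cons 1 s)) =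
          ∑ s : Fin n → Fin 2, ind 1 (labels lam ρ (Fin.cons 0 s)) := by
        refine Fintype.sum_equiv (Equiv.addRight fun _ => 1) _ _ fun s => ?_
        have e2 : (Fin.cons 1 s : Fin (n + 1) → Fin 2) =
            fun i => (Fin.cons 0 (s + fun _ => 1) : Fin (n + 1) → Fin 2) i + 1 := by
          funext i
          refine Fin.cases ?_ (fun i => ?_) i <;> simp [fin_two_add_one_add_one]
        rw [e2, h.labels_add_one, ind_map_flip _ _ (h.labels_ne _ _)]
        rfl
      rw [sum_fin_two_cons, Finset.sum_add_distrib, e, ← Finset.sum_add_distrib]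
      refine Finset.sum_congr rfl fun s _ => ?_
      rw [sum_ind_facet]
      rfl
    simp only [key]
    -- Facets omitting a lower vertex cancel in pairs, as do those omitting the top vertex when `ρ 0
    -- ≠ 0`; the equatorial ones remain.
    rw [Finset.sum_congr rfl fun ρ _ => Finset.sum_comm, Finset.sum_comm, Fin.sum_univ_succ,
      Finset.sum_eq_zero (s := univ) (f := fun j : Fin n => _), add_zero]
    · rw [← Equiv.Perm.decomposeFin.symm.sum_comp, Fintype.sum_prod_type, Fin.sum_univ_succ,
        Finset.sum_eq_zero (s := univ) (f := fun j : Fin n => _), add_zero]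
      · simp only [facet_zero_decomposeFin]
        exact ih h.cons_none
      · intro p _
        refine Finset.sum_eq_zero fun e _ => sum_ind_facet_zero _ _ ?_ _ _
        rw [Equiv.Perm.decomposeFin_symm_apply_zero]
        exact Fin.succ_ne_zero p
    · intro j _
      rw [Finset.sum_comm]
      exact Finset.sum_eq_zero fun s _ => sum_ind_facet_succ _ _ _ _

theorem val_add_one_fin_two (b : Fin 2) : ((b + 1 : Fin 2) : ℕ) = (b + 1) % 2 := by
  revert b; decide

theorem sign_of_altInd_ne_zero {b : Fin 2} {l : List Label} (h : altInd b l ≠ 0) (i : ℕ)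
    (hi : i < l.length) : ((ofLex l[i]).2 : ℕ) = (b + i) % 2 := by
  induction l generalizing b i with
  | nil => simp at hi
  | cons x l ih =>
    unfold altInd at h
    split_ifs at h with hx
    · cases i with
      | zero =>
        have := b.isLt
        simp only [List.getElem_cons_zero, hx]
        omega
      | succ i =>
        have := ih h i (by simpa using hi)
        rw [val_add_one_fin_two] at this
        rw [List.getElem_cons_succ, this]
        omega
    · exact absurd rfl h

/-- Neighbours have opposite signs, so equal absolute values would make them complementary. -/
theorem pairwise_lt_of_altInd_ne_zero {b : Fin 2} {l : List Label} (h : altInd b l ≠ 0)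
    (hs : l.Pairwise (· ≤ ·)) (hf : ∀ x ∈ l, ∀ y ∈ l, y ≠ flip x) :
    l.Pairwise fun x y => (ofLex x).1 < (ofLex y).1 := by
  induction l generalizing b with
  | nil => exact List.Pairwise.nil
  | cons x l ih =>
    unfold altInd at h
    split_ifs at h with hx
    · have ih' := ih h (List.pairwise_cons.1 hs).2
        fun x hx y hy => hf x (List.mem_cons_of_mem _ hx) y (List.mem_cons_of_mem _ hy)
      refine List.pairwise_cons.2 ⟨?_, ih'⟩
      cases l with
      | nil => simp
      | cons z t =>
        have hz : (ofLex z).2 = b + 1 := by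
          unfold altInd at h
          split_ifs at h with hz
          · exact hz
          · exact absurd rfl h
        have hxz : (ofLex x).1 < (ofLex z).1 := by
          have hle := (List.pairwise_cons.1 hs).1 z (by simp)
          rw [Prod.Lex.le_iff] at hle
          rcases hle with hlt | ⟨he, -⟩
          · exact hlt
          · refine absurd ?_ (hf x (by simp) z (by simp))
            refine ofLex_inj.1 (Prod.ext he.symm ?_)
            rw [hz, ← hx]
            rfl
        intro y hy
        rcases List.mem_cons.1 hy with rfl | hy
        · exact hxz
        · exact hxz.trans ((List.pairwise_cons.1 ih').1 y hy)
    · exact absurd rfl h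

/-- Ky Fan's lemma: a labelling has a flag whose labels, in increasing order, alternate in sign. -/
theorem IsFanLabelling.exists_alternating {n : ℕ} {lam : (Fin n → Option (Fin 2)) → Label}
    (h : IsFanLabelling lam) :
    ∃ (p : Fin n → Label) (s : Fin n → Fin 2), StrictMono (fun i => (ofLex (p i)).1) ∧
      (∀ i, ((ofLex (p i)).2 : ℕ) = i % 2) ∧
      ∀ i, ∃ X, (∃ a, X a ≠ none) ∧ (∀ a t, X a = some t → s a = t) ∧ lam X = p i := by
  obtain ⟨ρ, -, hρ⟩ := Finset.exists_ne_zero_of_sum_ne_zero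
    (h.sum_ind_labels.trans_ne one_ne_zero)
  obtain ⟨s, -, hs⟩ := Finset.exists_ne_zero_of_sum_ne_zero hρ
  have hne := h.labels_ne ρ s
  have hmem : ∀ x ∈ labels lam ρ s, ∃ X, (∃ a, X a ≠ none) ∧
      (∀ a t, X a = some t → s a = t) ∧ lam X = x := by
    intro x hx
    obtain ⟨j, -, rfl⟩ := Multiset.mem_map.1 hx
    refine ⟨_, exists_vertex_ne_none ρ s j, fun a t ht => ?_, rfl⟩
    unfold vertex at ht
    split_ifs at ht
    exact Option.some.inj ht
  have hcard : (labels lam ρ s).card = n := by simp [labels]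
  have hsort := Multiset.pairwise_sort (labels lam ρ s) (· ≤ ·)
  unfold ind at hs
  have hl : ((labels lam ρ s).sort (· ≤ ·) : Multiset Label) = labels lam ρ s :=
    Multiset.sort_eq _ _
  generalize (labels lam ρ s).sort (· ≤ ·) = l at hs hsort hl
  rw [← hl] at hne hmem hcard
  have hlen : l.length = n := by simpa using hcard
  subst hlen
  refine ⟨fun i => l[i], s, ?_, fun i => ?_, fun i => hmem _ (by simp)⟩
  · intro i j hij
    exact List.pairwise_iff_getElem.1 (pairwise_lt_of_altInd_ne_zero hs hsort (by simpa using hne))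
      i j i.2 j.2 hij
  · simpa using sign_of_altInd_ne_zero hs i i.2

/-! ### Alternating subsequences -/

/-- `j` selects a subsequence of non-zero, alternating terms of `x`. -/
structure IsAlternating {S : Type*} {n k : ℕ} (x : Fin n → Option S) (j : Fin k → Fin n) :
    Prop where
  strictMono : StrictMono j
  ne_none : ∀ i, x (j i) ≠ none
  ne : ∀ i i' : Fin k, (i : ℕ) + 1 = i' → x (j i) ≠ x (j i')

theorem bddAbove_alt {S : Type*} {n : ℕ} (x : Fin n → Option S) :
    BddAbove {k : ℕ | ∃ j : Fin k → Fin n, StrictMono j ∧ (∀ i, x (j i) ≠ none) ∧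
      ∀ i i' : Fin k, (i : ℕ) + 1 = i' → x (j i) ≠ x (j i')} := by
  refine ⟨n, ?_⟩
  rintro k ⟨j, hj, -⟩
  simpa using Fintype.card_le_of_injective j hj.injective

theorem IsAlternating.le_alt {S : Type*} {n k : ℕ} {x : Fin n → Option S} {j : Fin k → Fin n}
    (h : IsAlternating x j) : k ≤ alt x :=
  le_csSup (bddAbove_alt x) ⟨j, h.1, h.2, h.3⟩

theorem exists_isAlternating_alt {S : Type*} {n : ℕ} (x : Fin n → Option S) :
    ∃ j : Fin (alt x) → Fin n, IsAlternating x j := by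
  obtain ⟨j, h1, h2, h3⟩ := Nat.sSup_mem (s := {k : ℕ | ∃ j : Fin k → Fin n, StrictMono j ∧
    (∀ i, x (j i) ≠ none) ∧ ∀ i i' : Fin k, (i : ℕ) + 1 = i' → x (j i) ≠ x (j i')})
    ⟨0, Fin.elim0, fun i => i.elim0, fun i => i.elim0, fun i => i.elim0⟩ (bddAbove_alt x)
  exact ⟨j, h1, h2, h3⟩

theorem alt_pos {S : Type*} {n : ℕ} {x : Fin n → Option S} {a : Fin n} (h : x a ≠ none) :
    0 < alt x := by
  refine IsAlternating.le_alt (k := 1) (j := fun _ => a) ⟨Subsingleton.strictMono _, fun _ => h, ?_⟩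
  intro i i' e
  omega

/-- Otherwise the first non-zero term could be prepended, giving a longer alternating subsequence.
-/
theorem IsAlternating.apply_zero {S : Type*} {n k : ℕ} {x : Fin n → Option S}
    {j : Fin (k + 1) → Fin n} (h : IsAlternating x j) (hk : alt x ≤ k + 1) {a : Fin n}
    (ha : x a ≠ none) (hlt : ∀ a' < a, x a' = none) : x (j 0) = x a := by
  by_contra hne
  have haj : a < j 0 := by
    refine lt_of_le_of_ne (not_lt.1 fun hl => h.ne_none 0 (hlt _ hl)) ?_
    rintro rfl
    exact hne rfl
  have : IsAlternating x (Fin.cons a j : Fin (k + 2) → Fin n) := by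
    refine ⟨?_, ?_, ?_⟩
    · refine Fin.strictMono_iff_lt_succ.2 fun i => ?_
      refine Fin.cases (by simpa using haj) (fun i => ?_) i
      rw [← Fin.succ_castSucc, Fin.cons_succ, Fin.cons_succ]
      exact h.strictMono (Fin.castSucc_lt_succ)
    · intro i
      refine Fin.cases (by simpa using ha) (fun i => ?_) i
      simpa using h.ne_none i
    · intro i i'
      refine Fin.cases ?_ (fun i => ?_) i <;> refine Fin.cases ?_ (fun i' => ?_) i'
      · simp
      · intro e
        have : i' = 0 := by
          rw [Fin.ext_iff]
          simpa [eq_comm] using e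
        subst this
        simpa [eq_comm] using hne
      · simp
      · intro e
        simpa using h.ne i i' (by simpa using e)
  have := this.le_alt
  omega

/-! ### The labelling of the signed sets that comes from a coloring -/

section

variable {n : ℕ} (F : Finset (Finset (Fin n)))

/-- No part of the signed set `X` contains a member of `F`. -/
def Admissible (X : Fin n → Option (Fin 2)) : Prop :=
  ∀ s, ∀ A ∈ F, ¬ A ⊆ part X s

theorem Admissible.alt_le_altPerm {F : Finset (Finset (Fin n))} {X : Fin n → Option (Fin 2)}
    (h : Admissible F X) (hX : ∃ i, X i ≠ none) (σ : Equiv.Perm (Fin n)) :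
    alt (X ∘ σ) ≤ altPerm 2 F σ := by
  refine le_csSup ⟨n, ?_⟩ ⟨X, hX, h, rfl⟩
  rintro k ⟨X, -, -, rfl⟩
  exact alt_le _

/-- The label `p` is a label of `X`: if `X` is admissible, the sign is that of the first non-zero
term and the absolute value is determined by the alternation number; otherwise they come from a
member of `F` of the largest color that is contained in a part of `X`. -/
def HasLabel (σ : Equiv.Perm (Fin n)) (col : {A // A ∈ F} → ℕ) (X : Fin n → Option (Fin 2))
    (p : Label) : Prop :=
  (Admissible F X ∧ (∃ i, X (σ i) = some (ofLex p).2 ∧ ∀ i' < i, X (σ i') = none) ∧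
    (ofLex p).1 + 1 = alt (X ∘ σ)) ∨
  ∃ A : {A // A ∈ F}, A.1 ⊆ part X (ofLex p).2 ∧ (ofLex p).1 = altPerm 2 F σ + col A ∧
    ∀ B : {A // A ∈ F}, ∀ s, B.1 ⊆ part X s → col B ≤ col A

variable {F}

theorem part_mono {X Y : Fin n → Option (Fin 2)} (h : ∀ i s, X i = some s → Y i = some s)
    (s : Fin 2) : part X s ⊆ part Y s := by
  intro i
  simpa [part] using h i s

theorem disjoint_part (X : Fin n → Option (Fin 2)) {s t : Fin 2} (h : s ≠ t) :
    Disjoint (part X s) (part X t) := by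
  refine Finset.disjoint_left.2 fun i hi hi' => h ?_
  simp only [part, mem_filter, mem_univ, true_and] at hi hi'
  exact Option.some.inj (hi.symm.trans hi')

theorem part_antipode (X : Fin n → Option (Fin 2)) (s : Fin 2) :
    part (antipode X) (s + 1) = part X s := by
  ext i
  simp [part, antipode]

theorem alt_antipode (X : Fin n → Option (Fin 2)) (σ : Equiv.Perm (Fin n)) :
    alt (antipode X ∘ σ) = alt (X ∘ σ) := by
  have : ∀ a b : Option (Fin 2), a.map (· + 1) = b.map (· + 1) ↔ a = b := by decide
  simp [alt, antipode, this]

theorem Admissible.antipode {X : Fin n → Option (Fin 2)} (h : Admissible F X) :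
    Admissible F (antipode X) := by
  intro s A hA
  rw [← fin_two_add_one_add_one s, part_antipode]
  exact h _ A hA

theorem HasLabel.antipode {σ : Equiv.Perm (Fin n)} {col : {A // A ∈ F} → ℕ}
    {X : Fin n → Option (Fin 2)} {p : Label} (h : HasLabel F σ col X p) :
    HasLabel F σ col (antipode X) (flip p) := by
  rcases h with ⟨h1, ⟨i, hi, hlt⟩, h2⟩ | ⟨A, hA, h1, h2⟩
  · refine Or.inl ⟨h1.antipode, ⟨i, ?_, fun i' hi' => ?_⟩, ?_⟩
    · simp [KneserAlt.antipode, hi, flip]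
    · simp [KneserAlt.antipode, hlt i' hi']
    · rw [alt_antipode]
      exact h2
  · refine Or.inr ⟨A, ?_, h1, fun B s hB => ?_⟩
    · change A.1 ⊆ part _ ((ofLex p).2 + 1)
      rwa [part_antipode]
    · rw [← fin_two_add_one_add_one s, part_antipode] at hB
      exact h2 B _ hB

theorem HasLabel.ne_flip {σ : Equiv.Perm (Fin n)} {col : {A // A ∈ F} → ℕ} (hF : ∅ ∉ F)
    (hcol : ∀ A B, (kneserGraph F).Adj A B → col A ≠ col B)
    {X Y : Fin n → Option (Fin 2)} (hX : ∃ i, X i ≠ none)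
    (hXY : ∀ i s, X i = some s → Y i = some s) {p q : Label}
    (hp : HasLabel F σ col X p) (hq : HasLabel F σ col Y q) : q ≠ flip p := by
  rintro rfl
  rcases hp with ⟨hp1, ⟨a, ha, hlta⟩, hp2⟩ | ⟨A, hA, hp1, -⟩ <;>
  rcases hq with ⟨hq1, ⟨b, hb, hltb⟩, hq2⟩ | ⟨B, hB, hq1, -⟩
  -- Both are admissible with equal alternation numbers: a longest subsequence for `X` is also
  -- longest for `Y`, so their first signs agree.
  · change (ofLex p).1 + 1 = _ at hq2
    change _ = some ((ofLex p).2 + 1) at hb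
    obtain ⟨j, hj⟩ := exists_isAlternating_alt (X ∘ σ)
    generalize hk : alt (X ∘ σ) = k at *
    subst hp2
    have hjY : ∀ i, (Y ∘ σ) (j i) = (X ∘ σ) (j i) := by
      intro i
      obtain ⟨t, ht⟩ := Option.ne_none_iff_exists'.1 (hj.ne_none i)
      rw [ht]
      exact hXY _ _ ht
    have hj' : IsAlternating (Y ∘ σ) j := by
      refine ⟨hj.strictMono, fun i => ?_, fun i i' e => ?_⟩
      · rw [hjY]
        exact hj.ne_none i
      · rw [hjY, hjY]
        exact hj.ne i i' e
    have e1 := hj.apply_zero hk.le (a := a) (by simp [ha]) hlta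
    have e2 := hj'.apply_zero hq2.ge (a := b) (by simp [hb]) hltb
    rw [hjY, e1] at e2
    simp only [Function.comp, ha, hb, Option.some.injEq] at e2
    exact fin_two_add_one_ne _ e2.symm
  · have := hp1.alt_le_altPerm hX σ
    change (ofLex p).1 = _ at hq1
    omega
  · exact hq1 _ A.1 A.2 (hA.trans (part_mono hXY _))
  -- Two members of equal color would lie in opposite parts of `Y`, hence be adjacent.
  · change (ofLex p).1 = _ at hq1
    change _ ⊆ part Y ((ofLex p).2 + 1) at hB
    have hd : Disjoint A.1 B.1 := (disjoint_part Y (fin_two_add_one_ne (ofLex p).2).symm).mono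
      (hA.trans (part_mono hXY _)) hB
    refine hcol A B ⟨?_, hd⟩ (by omega)
    rintro rfl
    exact hF ((disjoint_self_iff_empty _).1 hd ▸ A.2)

theorem exists_first {σ : Equiv.Perm (Fin n)} {X : Fin n → Option (Fin 2)}
    (hX : ∃ i, X i ≠ none) : ∃ s i, X (σ i) = some s ∧ ∀ i' < i, X (σ i') = none := by
  obtain ⟨i, hi⟩ := hX
  obtain ⟨a, ha, hmin⟩ := wellFounded_lt.has_min {a | X (σ a) ≠ none}
    ⟨σ.symm i, by simpa using hi⟩
  obtain ⟨s, hs⟩ := Option.ne_none_iff_exists'.1 ha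
  exact ⟨s, a, hs, fun i' hi' => by_contra fun h => hmin i' h hi'⟩

theorem exists_hasLabel (σ : Equiv.Perm (Fin n)) (col : {A // A ∈ F} → ℕ)
    {X : Fin n → Option (Fin 2)} (hX : ∃ i, X i ≠ none) : ∃ p, HasLabel F σ col X p := by
  by_cases h : Admissible F X
  · obtain ⟨s, i, hi, hlt⟩ := exists_first (σ := σ) hX
    refine ⟨toLex (alt (X ∘ σ) - 1, s), Or.inl ⟨h, ⟨i, hi, hlt⟩, ?_⟩⟩
    have : 0 < alt (X ∘ σ) := alt_pos (a := i) (by simp [hi])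
    change alt (X ∘ σ) - 1 + 1 = _
    omega
  · unfold Admissible at h
    push Not at h
    obtain ⟨s, A, hA, hs⟩ := h
    obtain ⟨⟨B, t⟩, hB, hmax⟩ := Finset.exists_max_image
      (univ.filter fun q : {A // A ∈ F} × Fin 2 => q.1.1 ⊆ part X q.2) (fun q => col q.1)
      ⟨(⟨A, hA⟩, s), by simpa using hs⟩
    refine ⟨toLex (altPerm 2 F σ + col B, t), Or.inr ⟨B, by simpa using hB, rfl, fun C u hC => ?_⟩⟩
    exact hmax (C, u) (by simpa using hC)

/-- Labels can be chosen freely: `HasLabel` fixes the absolute value, and `HasLabel.ne_flip`,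
applied to a signed set and itself, fixes the sign. This gives antipodality. -/
theorem exists_isFanLabelling (hF : ∅ ∉ F) (σ : Equiv.Perm (Fin n)) (col : {A // A ∈ F} → ℕ)
    (hcol : ∀ A B, (kneserGraph F).Adj A B → col A ≠ col B) :
    ∃ lam, IsFanLabelling lam ∧ ∀ X, (∃ i, X i ≠ none) → HasLabel F σ col X (lam X) := by
  have key : ∀ X, ∃ p, (∃ i, X i ≠ none) → HasLabel F σ col X p := by
    intro X
    by_cases hX : ∃ i, X i ≠ none
    · obtain ⟨p, hp⟩ := exists_hasLabel σ col hX
      exact ⟨p, fun _ => hp⟩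
    · exact ⟨toLex (0, 0), fun h => absurd h hX⟩
  choose lam hlam using key
  have hanti : ∀ X : Fin n → Option (Fin 2), (∃ i, X i ≠ none) → ∃ i, antipode X i ≠ none := by
    rintro X ⟨i, hi⟩
    exact ⟨i, by simpa [antipode] using hi⟩
  refine ⟨lam, ⟨fun X hX => ?_, fun X Y hX hXY => ?_⟩, hlam⟩
  · have h1 := hlam _ (hanti X hX)
    have h2 := (hlam X hX).antipode
    have h3 := h1.ne_flip hF hcol (hanti X hX) (fun _ _ => id) h2
    have h4 : (ofLex (lam (antipode X))).1 = (ofLex (flip (lam X))).1 := by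
      rcases h1 with ⟨a1, -, b1⟩ | ⟨A, a1, b1, c1⟩ <;>
        rcases h2 with ⟨a2, -, b2⟩ | ⟨B, a2, b2, c2⟩
      · omega
      · exact absurd a2 (a1 _ B.1 B.2)
      · exact absurd a1 (a2 _ A.1 A.2)
      · have := c1 B _ a2
        have := c2 A _ a1
        omega
    by_contra hne
    refine h3 (ofLex_inj.1 (Prod.ext h4.symm (fin_two_eq_add_one_of_ne fun e => hne ?_)))
    exact ofLex_inj.1 (Prod.ext h4 e.symm)
  · obtain ⟨i, hi⟩ := hX
    obtain ⟨s, hs⟩ := Option.ne_none_iff_exists'.1 hi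
    refine (hlam X ⟨i, hi⟩).ne_flip hF hcol ⟨i, hi⟩ hXY (hlam Y ⟨i, ?_⟩)
    simp [hXY i s hs]

/-- A proper coloring has a sequence of members of `F`, of increasing colors, such that members
at positions of different parity are disjoint. -/
theorem exists_zigzag (hF : ∅ ∉ F) (σ : Equiv.Perm (Fin n)) (col : {A // A ∈ F} → ℕ)
    (hcol : ∀ A B, (kneserGraph F).Adj A B → col A ≠ col B) :
    ∃ A : Fin (n - altPerm 2 F σ) → {A // A ∈ F}, StrictMono (fun i => col (A i)) ∧
      ∀ i j : Fin _, (i : ℕ) % 2 ≠ j % 2 → (kneserGraph F).Adj (A i) (A j) := by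
  obtain ⟨lam, hlam, hlab⟩ := exists_isFanLabelling hF σ col hcol
  obtain ⟨p, s, hp, hsign, hX⟩ := hlam.exists_alternating
  have hge : ∀ i : Fin n, (i : ℕ) ≤ (ofLex (p i)).1 := by
    rintro ⟨i, hi⟩
    induction i with
    | zero => exact Nat.zero_le _
    | succ i ih =>
      exact (ih (by omega)).trans_lt (hp (Fin.mk_lt_mk.2 (Nat.lt_succ_self i)))
  let e : Fin (n - altPerm 2 F σ) → Fin n := fun i => ⟨altPerm 2 F σ + i, by omega⟩
  have key : ∀ i, ∃ A : {A // A ∈ F}, A.1 ⊆ part (fun a => some (s a)) (ofLex (p (e i))).2 ∧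
      (ofLex (p (e i))).1 = altPerm 2 F σ + col A := by
    intro i
    obtain ⟨X, hX0, hXs, hXp⟩ := hX (e i)
    have h := hlab X hX0
    rw [hXp] at h
    -- An admissible set would have absolute value below `altPerm 2 F σ`, but the label at `e i` is
    -- at least its position.
    rcases h with ⟨h1, -, h2⟩ | ⟨A, hA, h1, -⟩
    · have h3 := h1.alt_le_altPerm hX0 σ
      have h4 := hge (e i)
      change altPerm 2 F σ + i ≤ _ at h4
      omega
    · exact ⟨A, hA.trans (part_mono (fun a t h => congrArg some (hXs a t h)) _), h1⟩
  choose A hA hc using key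
  refine ⟨A, fun i j hij => ?_, fun i j hij => ?_⟩
  · have : e i < e j := Fin.mk_lt_mk.2 (by omega)
    have := hp this
    simp only [hc] at this
    simpa using this
  · have hd : Disjoint (A i).1 (A j).1 := by
      refine (disjoint_part _ fun h => hij ?_).mono (hA i) (hA j)
      have h2 := congrArg Fin.val h
      rw [hsign, hsign] at h2
      change (altPerm 2 F σ + (i : ℕ)) % 2 = (altPerm 2 F σ + (j : ℕ)) % 2 at h2
      omega
    refine ⟨fun h => ?_, hd⟩
    rw [← h] at hd
    exact hF ((disjoint_self_iff_empty _).1 hd ▸ (A i).2)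

end

/-! ### Placing the zig-zag on the two sides of the bipartite graph -/

/-- The position of a vertex of the bipartite graph in the zig-zag order. -/
def zigzagIndex (r : ℕ) : Fin ((r + 1) / 2) ⊕ Fin (r / 2) → Fin r
  | Sum.inl a => ⟨2 * a, by omega⟩
  | Sum.inr b => ⟨2 * b + 1, by omega⟩

theorem zigzagIndex_mod_two {r : ℕ} (u : Fin ((r + 1) / 2) ⊕ Fin (r / 2)) :
    (zigzagIndex r u : ℕ) % 2 = if u.isLeft then 0 else 1 := by
  rcases u with a | b
  · simp [zigzagIndex]
  · simp [zigzagIndex]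

theorem zigzagIndex_injective (r : ℕ) : Function.Injective (zigzagIndex r) := by
  rintro (a | a) (b | b) h <;> simp only [zigzagIndex, Fin.mk.injEq] at h
  · exact congrArg Sum.inl (Fin.ext (by omega))
  · omega
  · omega
  · exact congrArg Sum.inr (Fin.ext (by omega))

theorem zigzagIndex_surjective (r : ℕ) : Function.Surjective (zigzagIndex r) := by
  rintro ⟨i, hi⟩
  rcases Nat.even_or_odd' i with ⟨a, rfl | rfl⟩
  · exact ⟨Sum.inl ⟨a, by omega⟩, rfl⟩
  · exact ⟨Sum.inr ⟨a, by omega⟩, rfl⟩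

end KneserAlt

theorem mainTheorem6 (n : ℕ) (F : Finset (Finset (Fin n))) (hF : ∅ ∉ F)
    (r : ℕ) (hr : r = n - KneserAlt.altNumber 2 F)
    (k : ℕ) (h : (KneserAlt.kneserGraph F).Coloring (Fin k)) :
    ∃ K : SimpleGraph.Copy
        (completeBipartiteGraph (Fin ((r + 1) / 2)) (Fin (r / 2))) (KneserAlt.kneserGraph F),
      Function.Injective (fun v => h (K v)) ∧
      KneserAlt.ColorsAlternate (fun v => h (K v)) := by
  obtain ⟨σ, hσ⟩ : ∃ σ, KneserAlt.altPerm 2 F σ = KneserAlt.altNumber 2 F :=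
    exists_eq_ciInf_of_finite
  rw [← hσ] at hr
  subst hr
  obtain ⟨A, hA, hadj⟩ := KneserAlt.exists_zigzag hF σ (fun B => (h B : ℕ))
    fun B C hBC e => h.valid hBC (Fin.ext e)
  generalize n - KneserAlt.altPerm 2 F σ = r at A hA hadj
  have hmono : StrictMono fun i => h (A i) := fun i j hij => hA hij
  have hinj : Function.Injective fun v => h (A (KneserAlt.zigzagIndex r v)) :=
    hmono.injective.comp (KneserAlt.zigzagIndex_injective r)
  refine ⟨⟨⟨fun v => A (KneserAlt.zigzagIndex r v), fun {u v} huv => hadj _ _ ?_⟩, ?_⟩, hinj, ?_⟩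
  · rw [KneserAlt.zigzagIndex_mod_two, KneserAlt.zigzagIndex_mod_two]
    rcases u with a | a <;> rcases v with b | b <;> simp at huv ⊢
  · intro u v huv
    exact hinj (congrArg h huv)
  · intro u v huv hbetween hside
    change h (A _) < h (A _) at huv
    rw [hmono.lt_iff_lt] at huv
    have h1 := KneserAlt.zigzagIndex_mod_two u
    have h2 := KneserAlt.zigzagIndex_mod_two v
    rw [hside, ← h2] at h1
    -- On one side the positions have equal parity, so they differ by at least `2` and the next
    -- position has a color strictly between.
    obtain ⟨w, hw⟩ := KneserAlt.zigzagIndex_surjective r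
      ⟨KneserAlt.zigzagIndex r u + 1, by omega⟩
    refine hbetween w ⟨hmono ?_, hmono ?_⟩ <;> rw [hw, Fin.lt_def] <;> simp only <;> omega
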